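/- Let $\mathfrak g$ be a finite-dimensional complex simple Lie algebra with Cartan subalgebra $\mathfrak h$, simple roots $\alpha_1,\dots,\alpha_l$, simple coroots $\alpha_i^\vee$, and fundamental weights $\omega_1,\dots,\omega_l$ (so $\omega_i(\alpha_j^\vee)=\delta_{ij}$). For weights $\mu,\nu$ write $\mu\preceq\nu$ if $\nu-\mu=\sum_i n_i\alpha_i$ with all $n_i\in\mathbb Z_{\ge 0}$. Let $\chi_i$ be the formal character of the irreducible representation of highest weight $\omega_i$, let $\rho_\omega$ be an irreducible finite-dimensional representation with highest weight $\omega\neq 0$, put $d=\dim\rho_\omega$, and let $\Gamma(\wedge^k\rho_\omega)$ be the set of weights of $\wedge^k\rho_\omega$. For $k\ge 0$ let $N^{(\omega,k)}_\iota\in\mathbb Z$ be the coefficients of the expansion of the exterior character as an integer polynomial in the fundamental characters, $$\chi_{\wedge^k\rho_\omega}=\sum_{\iota\in\mathbb Z_{\ge 0}^l}N^{(\omega,k)}_\iota\prod_{i=1}^l\chi_i^{\iota_i}.$$ Let $\Pi_\omega$ be any pivotal set for $\omega$, that is, a set of dominant weights $\Pi_\omega\subseteq\bigcup_k\Gamma(\wedge^k\rho_\omega)$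 such that for every $j$ with $1\le j\le\lfloor d/2\rfloor$ and every $\varpi'\in\Gamma(\wedge^j\rho_\omega)$ there is $\varpi\in\Pi_\omega$ with $\varpi'\preceq\varpi$. Call $\iota\in\mathbb Z_{\ge0}^l$ admissible, $\iota\in\mathfrak I_\omega$, if $\sum_i\iota_i\omega_i\preceq\varpi$ for some $\varpi\in\Pi_\omega$. Then the set $\mathfrak I_\omega$ is finite, and $$\iota\notin\mathfrak I_\omega\ \Longrightarrow\ N^{(\omega,k)}_\iota=0$$ for all $k$ with $1\le k\le\lfloor d/2\rfloor$. If $\mathfrak g$ is of type $E_6$, this implication also holds for $k=0$. If $\mathfrak g$ is of type $E_7$, $E_8$, $F_4$ or $G_2$, it holds for all $k\ge 0$. -/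

import Mathlib

open Module LieAlgebra

noncomputable section

/-! ### The Lie algebra action on exterior powers -/

namespace ExteriorLie

variable {R M : Type*} [CommRing R] [AddCommGroup M] [Module R M]

/-- The alternating map
`(v₁, …, vₖ) ↦ ∑ᵢ v₁ ∧ ⋯ ∧ f vᵢ ∧ ⋯ ∧ vₖ` attached to an endomorphism `f`. -/
def derAlt (k : ℕ) (f : Module.End R M) : M [⋀^Fin k]→ₗ[R] (⋀[R]^k M) where
  toMultilinearMap := ∑ i : Fin k,
    (exteriorPower.ιMulti R k (M := M)).toMultilinearMap.compLinearMap
      (Function.update (fun _ => LinearMap.id) i f)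
  map_eq_zero_of_eq' := by
    intro v a b hab hne
    have key : ∀ (i : Fin k), (fun j => (Function.update (fun _ => LinearMap.id) i f :
        Fin k → M →ₗ[R] M) j (v j)) = Function.update v i (f (v i)) := by
      intro i
      funext j
      by_cases h : j = i
      · subst h; simp
      · simp [h]
    simp only [sum_apply, MultilinearMap.compLinearMap_apply, key,
      AlternatingMap.coe_multilinearMap, MultilinearMap.toFun_eq_coe]
    rw [Finset.sum_eq_add_of_mem a b (Finset.mem_univ _) (Finset.mem_univ _) hne]
    · have h : Function.update v b (f (v b))
          = (Function.update v a (f (v a))) ∘ Equiv.swap a b := by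
        funext j
        by_cases hja : j = a
        · subst hja; simp [hne, hne.symm, hab]
        · by_cases hjb : j = b
          · subst hjb; simp [hab]
          · simp [Equiv.swap_apply_of_ne_of_ne hja hjb, hja, hjb]
      rw [h, AlternatingMap.map_swap _ _ hne]
      simp
    · intro c _ hc
      refine AlternatingMap.map_eq_zero_of_eq _ _ (i := a) (j := b) ?_ hne
      simp [hc.1.symm, hc.2.symm, hab]

/-- The derivation extension of `f : End M` to the exterior power `⋀ᵏ M`. -/
def extDer (k : ℕ) (f : Module.End R M) : Module.End R (⋀[R]^k M) :=
  exteriorPower.alternatingMapLinearEquiv (derAlt k f)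

theorem extDer_ιMulti (k : ℕ) (f : Module.End R M) (v : Fin k → M) :
    extDer k f (exteriorPower.ιMulti R k v)
      = ∑ i, exteriorPower.ιMulti R k (Function.update v i (f (v i))) := by
  have key : ∀ (i : Fin k), (fun j => (Function.update (fun _ => LinearMap.id) i f :
      Fin k → M →ₗ[R] M) j (v j)) = Function.update v i (f (v i)) := by
    intro i
    funext j
    by_cases h : j = i
    · subst h; simp
    · simp [h]
  rw [extDer, exteriorPower.alternatingMapLinearEquiv_apply_ιMulti]
  change (∑ i : Fin k, (exteriorPower.ιMulti R k (M := M)).toMultilinearMap.compLinearMap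
      (Function.update (fun _ => LinearMap.id) i f)) v = _
  simp only [sum_apply, MultilinearMap.compLinearMap_apply, key,
    AlternatingMap.coe_multilinearMap]

theorem extDer_add (k : ℕ) (f g : Module.End R M) :
    extDer k (f + g) = extDer k f + extDer k g := by
  apply exteriorPower.linearMap_ext
  ext1 v
  simp [extDer_ιMulti, Finset.sum_add_distrib]

theorem extDer_smul (k : ℕ) (c : R) (f : Module.End R M) :
    extDer k (c • f) = c • extDer k f := by
  apply exteriorPower.linearMap_ext
  ext1 v
  simp [extDer_ιMulti, Finset.smul_sum]

theorem extDer_commutator (k : ℕ) (f g : Module.End R M) :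
    extDer k (f * g - g * f) = extDer k f * extDer k g - extDer k g * extDer k f := by
  apply exteriorPower.linearMap_ext
  ext1 v
  have key : ∀ f g : Module.End R M, extDer k f (extDer k g (exteriorPower.ιMulti R k v))
      = ∑ i, (exteriorPower.ιMulti R k (Function.update v i (f (g (v i))))
        + ∑ j ∈ Finset.univ.erase i, exteriorPower.ιMulti R k
            (Function.update (Function.update v i (g (v i))) j (f (v j)))) := by
    intro f g
    rw [extDer_ιMulti, map_sum]
    refine Finset.sum_congr rfl fun i _ => ?_
    rw [extDer_ιMulti, ← Finset.add_sum_erase _ _ (Finset.mem_univ i)]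
    congr 1
    · simp
    · refine Finset.sum_congr rfl fun j hj => ?_
      rw [Function.update_of_ne (Finset.ne_of_mem_erase hj)]
  have sym : ∑ i, ∑ j ∈ Finset.univ.erase i, exteriorPower.ιMulti R k
        (Function.update (Function.update v i (g (v i))) j (f (v j)))
      = ∑ i, ∑ j ∈ Finset.univ.erase i, exteriorPower.ιMulti R k
        (Function.update (Function.update v i (f (v i))) j (g (v j))) := by
    rw [Finset.sum_comm' (t' := Finset.univ) (s' := fun j => Finset.univ.erase j)
      (by intro x y; simp [ne_comm])]
    refine Finset.sum_congr rfl fun i _ => Finset.sum_congr rfl fun j hj => ?_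
    rw [Function.update_comm (Finset.ne_of_mem_erase hj)]
  simp only [LinearMap.compAlternatingMap_apply, LinearMap.sub_apply, Module.End.mul_apply,
    key, Finset.sum_add_distrib, sym]
  rw [extDer_ιMulti]
  simp [Finset.sum_sub_distrib]

variable {L : Type*} [LieRing L] [LieAlgebra R L] [LieRingModule L M] [LieModule R L M]

/-- The exterior power of a representation:
`x · (v₁ ∧ ⋯ ∧ vₖ) = ∑ᵢ v₁ ∧ ⋯ ∧ x · vᵢ ∧ ⋯ ∧ vₖ`. -/
instance lieRingModule (k : ℕ) : LieRingModule L (⋀[R]^k M) where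
  bracket x w := extDer k (LieModule.toEnd R L M x) w
  add_lie x y w := by
    change extDer k _ w = extDer k _ w + extDer k _ w
    rw [map_add, extDer_add, LinearMap.add_apply]
  lie_add x w w' := map_add _ w w'
  leibniz_lie x y w := by
    change extDer k _ (extDer k _ w) = extDer k _ w + extDer k _ (extDer k _ w)
    have h : LieModule.toEnd R L M ⁅x, y⁆ = LieModule.toEnd R L M x * LieModule.toEnd R L M y
        - LieModule.toEnd R L M y * LieModule.toEnd R L M x := by
      ext m; simp
    rw [h, extDer_commutator]
    simp

theorem lie_ιMulti (k : ℕ) (x : L) (v : Fin k → M) :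
    ⁅x, exteriorPower.ιMulti R k v⁆
      = ∑ i, exteriorPower.ιMulti R k (Function.update v i ⁅x, v i⁆) :=
  extDer_ιMulti k (LieModule.toEnd R L M x) v

instance lieModule (k : ℕ) : LieModule R L (⋀[R]^k M) where
  smul_lie c x w := by
    change extDer k _ w = c • extDer k _ w
    rw [map_smul, extDer_smul, LinearMap.smul_apply]
  lie_smul c x w := by
    change extDer k _ (c • w) = c • extDer k _ w
    rw [map_smul]

end ExteriorLie

/-! ### Weights and formal characters -/

section Characters

variable {L : Type*} [LieRing L] [LieAlgebra ℂ L] (H : LieSubalgebra ℂ L) [H.IsCartanSubalgebra]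
  (V : Type*) [AddCommGroup V] [Module ℂ V] [LieRingModule L V] [LieModule ℂ L V]

/-- The multiplicity of the weight `μ` in `V`: the dimension of
`{v ∈ V | h · v = μ(h) v for all h ∈ H}`. -/
def weightMult (μ : Dual ℂ H) : ℕ := finrank ℂ (LieModule.weightSpace V (μ : H → ℂ))

/-- The weight system `Γ(V)`. -/
def weightSystem : Set (Dual ℂ H) := {μ | LieModule.weightSpace V (μ : H → ℂ) ≠ ⊥}

theorem finite_support_weightMult [FiniteDimensional ℂ V] :
    (Function.support fun μ : Dual ℂ H => (weightMult H V μ : ℤ)).Finite := by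
  have h := LieModule.finite_genWeightSpace_ne_bot ℂ H V
  refine Set.Finite.subset (h.preimage (f := fun μ : Dual ℂ H => (μ : H → ℂ))
    DFunLike.coe_injective.injOn) fun μ hμ => ?_
  simp only [Set.mem_preimage, Set.mem_ofPred_eq]
  intro h0
  apply hμ
  have h1 : LieModule.weightSpace V (μ : H → ℂ) = ⊥ :=
    le_bot_iff.mp (h0 ▸ LieModule.weightSpace_le_genWeightSpace V (μ : H → ℂ))
  simp only [weightMult]
  rw [h1]
  exact_mod_cast finrank_bot ℂ V

/-- The formal character `∑_μ (dim V_μ) e^μ`, an element of the group ring `ℤ[H*]`. -/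
def formalChar [FiniteDimensional ℂ V] : AddMonoidAlgebra ℤ (Dual ℂ H) :=
  .ofCoeff (Finsupp.ofSupportFinite (fun μ => (weightMult H V μ : ℤ))
    (finite_support_weightMult H V))

end Characters

/-! ### Dominant weights, highest weights, and pivotal sets -/

section Weights

variable {L : Type*} [LieRing L] [LieAlgebra ℂ L] [FiniteDimensional ℂ L] [IsKilling ℂ L]
  {H : LieSubalgebra ℂ L} [H.IsCartanSubalgebra]
  (b : (IsKilling.rootSystem H).Base)

/-- The fundamental weight `ω_i`, dual to the simple coroots: `ω_i(α_j^∨) = δ_ij`. -/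
def fundWeight (i : b.support) : Dual ℂ H := b.toCoweightBasis.coord i

open scoped Classical in
theorem fundWeight_coroot (i j : b.support) :
    fundWeight b i ((IsKilling.rootSystem H).coroot j) = if j = i then 1 else 0 := by
  rw [← b.toCoweightBasis_apply j, fundWeight, Basis.coord_apply, Basis.repr_self,
    Finsupp.single_apply]

/-- The canonical partial order on weights: `μ ≼ ν` iff `ν - μ` is a sum of simple roots with
coefficients in `ℕ`. -/
def WeightLE (μ ν : Dual ℂ H) : Prop :=
  ∃ n : b.support → ℕ, ν - μ = ∑ i, n i • (IsKilling.rootSystem H).root i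

/-- Dominant integral weights. -/
def IsDominant (μ : Dual ℂ H) : Prop :=
  ∀ i ∈ b.support, ∃ m : ℕ, μ ((IsKilling.rootSystem H).coroot i) = m

/-- `V` is the irreducible representation with highest weight `lam`: it is irreducible and has a
nonzero vector of weight `lam` that is annihilated by all positive root spaces. -/
def IsIrredOfHighestWeight (V : Type*) [AddCommGroup V] [Module ℂ V] [LieRingModule L V]
    [LieModule ℂ L V] (lam : Dual ℂ H) : Prop :=
  LieModule.IsIrreducible ℂ L V ∧
    ∃ v ∈ LieModule.weightSpace V (lam : H → ℂ), v ≠ 0 ∧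
      ∀ α : H.root, b.IsPos α → ∀ x ∈ rootSpace H (α : H → ℂ), ⁅x, v⁆ = 0

/-- A set `Pi` of dominant weights occurring in the exterior powers of `V` is pivotal if every
weight of `⋀ʲ V`, for `1 ≤ j ≤ ⌊dim V / 2⌋`, is dominated by an element of `Pi`. -/
structure IsPivotal (V : Type*) [AddCommGroup V] [Module ℂ V] [LieRingModule L V]
    [LieModule ℂ L V] (Pi : Set (Dual ℂ H)) : Prop where
  dominant : ∀ ϖ ∈ Pi, IsDominant b ϖ
  subset : Pi ⊆ ⋃ k : ℕ, weightSystem H (⋀[ℂ]^k V)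
  dominates : ∀ j : ℕ, 1 ≤ j → j ≤ finrank ℂ V / 2 →
    ∀ ϖ' ∈ weightSystem H (⋀[ℂ]^j V), ∃ ϖ ∈ Pi, WeightLE b ϖ' ϖ

/-- The multi-exponents `ι` that are admissible with respect to `Pi`: `∑ᵢ ιᵢ ωᵢ` is dominated by
an element of `Pi`. -/
def admissibleExponents (Pi : Set (Dual ℂ H)) : Set (b.support →₀ ℕ) :=
  {ι | ∃ ϖ ∈ Pi, WeightLE b (∑ i, ι i • fundWeight b i) ϖ}

/-- The Cartan matrix is `C`, for some numbering of the simple roots. -/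
def HasCartanMatrix {n : ℕ} (C : Matrix (Fin n) (Fin n) ℤ) : Prop :=
  ∃ e : b.support ≃ Fin n, ∀ i j, b.cartanMatrix i j = C (e i) (e j)

end Weights

end

noncomputable section

/-! ### The order on weights -/

section WeightOrder

variable {L : Type*} [LieRing L] [LieAlgebra ℂ L] [FiniteDimensional ℂ L] [IsKilling ℂ L]
  {H : LieSubalgebra ℂ L} [H.IsCartanSubalgebra]
  (b : (IsKilling.rootSystem H).Base)

/-! The argument is triangularity. The monomial `∏ χ_i ^ ι_i` contains `e^(∑ ι_i ω_i)` with
coefficient 1, and its other exponents are strictly lower. Among the monomials of the expansion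
whose leading weight is not below `Pi`, choose one with maximal leading weight. No other monomial
can cancel that exponent, so it is a weight of the exterior power
(`coeff_eq_zero_of_forall_dominant`). It therefore suffices that every weight of `⋀ᵏ V` lies below
`Pi`, and for `1 ≤ k ≤ d/2` this is pivotality.

For `k = 0` one needs `0 ≼ ϖ` for some `ϖ ∈ Pi`. Let `e` be the absolute value of the Cartan
determinant, which multiplies integral weights into the root lattice. A sum of `e` weights of `V` is
congruent to `eω`, hence lies in the root lattice, and so does any element of `Pi` above it. A
dominant element of the root lattice is `≽ 0`, since the inverse Cartan matrix has no negative
entries. Pivotality applies to `⋀ᵉ V` when `e ≤ d/2`, which follows from `2e ≤ rank ≤ d`; the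
exceptional types satisfy the first inequality.

For `k > d/2`, the weights of `⋀ᵏ V` are the negatives of those of `⋀^(d-k) V`. In types E₇, E₈, F₄,
G₂ the Weyl group contains `-1`, so these sets of weights are symmetric and the case reduces to `d -
k ≤ d/2`.

Finiteness holds because `Pi` is finite and only finitely many dominant weights lie below a given
one. -/

theorem simpleRoots_linearIndependent :
    LinearIndependent ℂ fun i : b.support => (IsKilling.rootSystem H).root i :=
  b.linearIndepOn_root

theorem weightLE_refl (μ : Dual ℂ H) : WeightLE b μ μ := ⟨0, by simp⟩

variable {b}

theorem WeightLE.trans {μ ν ξ : Dual ℂ H} (h₁ : WeightLE b μ ν) (h₂ : WeightLE b ν ξ) :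
    WeightLE b μ ξ := by
  obtain ⟨m, hm⟩ := h₁
  obtain ⟨n, hn⟩ := h₂
  refine ⟨n + m, ?_⟩
  simp only [Pi.add_apply, add_smul, Finset.sum_add_distrib, ← hm, ← hn]
  abel

theorem WeightLE.add {μ ν μ' ν' : Dual ℂ H} (h₁ : WeightLE b μ ν) (h₂ : WeightLE b μ' ν') :
    WeightLE b (μ + μ') (ν + ν') := by
  obtain ⟨m, hm⟩ := h₁
  obtain ⟨n, hn⟩ := h₂
  refine ⟨m + n, ?_⟩
  simp only [Pi.add_apply, add_smul, Finset.sum_add_distrib, ← hm, ← hn]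
  abel

theorem eq_zero_of_sum_nsmul_root_eq_zero {n : b.support → ℕ}
    (h : ∑ i, n i • (IsKilling.rootSystem H).root i = 0) : n = 0 := by
  have := Fintype.linearIndependent_iff.mp (simpleRoots_linearIndependent b) (fun i => (n i : ℂ))
    (by simpa only [Nat.cast_smul_eq_nsmul] using h)
  ext i
  exact_mod_cast this i

theorem WeightLE.antisymm {μ ν : Dual ℂ H} (h₁ : WeightLE b μ ν) (h₂ : WeightLE b ν μ) :
    μ = ν := by
  obtain ⟨m, hm⟩ := h₁
  obtain ⟨n, hn⟩ := h₂
  have h : m + n = 0 := eq_zero_of_sum_nsmul_root_eq_zero (b := b) <| by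
    simp only [Pi.add_apply, add_smul, Finset.sum_add_distrib, ← hm, ← hn]
    abel
  have hm0 : m = 0 := by
    ext i
    have := congrFun h i
    simp only [Pi.add_apply, Pi.zero_apply] at this ⊢
    omega
  rw [hm0] at hm
  simpa [sub_eq_zero, eq_comm] using hm

theorem weightLE_sub_of_isPos {α : H.root} (hα : b.IsPos α) (μ : Dual ℂ H) :
    WeightLE b (μ - (IsKilling.rootSystem H).root α) μ := by
  obtain ⟨f, hf, h | h⟩ := b.exists_root_eq_sum_nat_or_neg α
  · refine ⟨fun i => f i, ?_⟩
    rw [sub_sub_cancel, h, ← Finset.sum_coe_sort]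
  · exfalso
    have : b.height α = ∑ j ∈ b.support, -(f j : ℤ) := by
      refine RootPairing.Base.height_eq_sum (f := fun j => -(f j : ℤ)) ?_
      simpa using h
    have h0 : 0 < b.height α := hα
    rw [this, Finset.sum_neg_distrib] at h0
    have : (0 : ℤ) ≤ ∑ j ∈ b.support, (f j : ℤ) := Finset.sum_nonneg fun _ _ => by positivity
    linarith

variable (b)

/-- The root lattice, as the integral combinations of simple roots. -/
def rootLattice : AddSubgroup (Dual ℂ H) :=
  AddSubgroup.closure (Set.range fun i : b.support => (IsKilling.rootSystem H).root i)

variable {b}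

theorem sum_zsmul_root_mem_rootLattice (n : b.support → ℤ) :
    ∑ i, n i • (IsKilling.rootSystem H).root i ∈ rootLattice b :=
  AddSubgroup.sum_mem _ fun i _ =>
    AddSubgroup.zsmul_mem _ (AddSubgroup.subset_closure (Set.mem_range_self i)) _

theorem mem_rootLattice_iff {μ : Dual ℂ H} :
    μ ∈ rootLattice b ↔ ∃ n : b.support → ℤ, μ = ∑ i, n i • (IsKilling.rootSystem H).root i := by
  classical
  refine ⟨fun h => ?_, ?_⟩
  · induction h using AddSubgroup.closure_induction with
    | mem x hx =>
      obtain ⟨i, rfl⟩ := hx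
      exact ⟨Pi.single i 1, by simp [Pi.single_apply, ite_smul]⟩
    | zero => exact ⟨0, by simp⟩
    | add x y _ _ hx hy =>
      obtain ⟨m, rfl⟩ := hx
      obtain ⟨n, rfl⟩ := hy
      exact ⟨m + n, by simp [add_smul, Finset.sum_add_distrib]⟩
    | neg x _ hx =>
      obtain ⟨m, rfl⟩ := hx
      exact ⟨-m, by simp⟩
  · rintro ⟨n, rfl⟩
    exact sum_zsmul_root_mem_rootLattice n

theorem WeightLE.sub_mem_rootLattice {μ ν : Dual ℂ H} (h : WeightLE b μ ν) :
    ν - μ ∈ rootLattice b := by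
  obtain ⟨n, hn⟩ := h
  rw [hn]
  exact AddSubgroup.sum_mem _ fun i _ =>
    AddSubgroup.nsmul_mem _ (AddSubgroup.subset_closure (Set.mem_range_self i)) _

open Matrix in
-- Let `q` be the negative part of `n` and `D` a positive diagonal matrix making `AD` positive
-- definite. If `q ≠ 0`, then `(n + q)AD·q > 0`. But `n + q` is the positive part, with support
-- disjoint from that of `q`, so only the nonpositive off-diagonal entries of `A` contribute.
theorem nonneg_of_vecMul_cartanMatrix_nonneg {n : b.support → ℤ}
    (h : ∀ i, 0 ≤ (n ᵥ* b.cartanMatrix) i) (i : b.support) : 0 ≤ n i := by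
  classical
  obtain ⟨d, hd, hA⟩ := b.exists_cartanMatrix_mul_diagaonal_posDef
  set q : b.support → ℤ := fun i => max (-n i) 0 with hq
  suffices q = 0 by
    have := congrFun this i
    simp only [hq, Pi.zero_apply] at this
    omega
  by_contra hq0
  have h1 : 0 < q ⬝ᵥ ((b.cartanMatrix * diagonal d) *ᵥ q) := by
    simpa using hA.dotProduct_mulVec_pos hq0
  have h2 : 0 ≤ (n ᵥ* b.cartanMatrix) ⬝ᵥ (diagonal d *ᵥ q) := by
    refine Finset.sum_nonneg fun i _ => mul_nonneg (h i) ?_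
    rw [mulVec_diagonal]
    exact mul_nonneg (hd i).le (le_max_right _ _)
  have h3 : ((n + q) ᵥ* b.cartanMatrix) ⬝ᵥ (diagonal d *ᵥ q) ≤ 0 := by
    have hv : diagonal d *ᵥ q = fun j => d j * q j := funext fun j => mulVec_diagonal _ _ _
    rw [← dotProduct_mulVec, hv]
    simp only [dotProduct, mulVec, Finset.mul_sum]
    refine Finset.sum_nonpos fun i _ => Finset.sum_nonpos fun j _ => ?_
    change (n i + q i) * (b.cartanMatrix i j * (d j * q j)) ≤ 0
    rcases eq_or_ne i j with rfl | hij
    · have : (n i + q i) * q i = 0 := by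
        simp only [hq]
        rcases le_total (-n i) 0 with h | h
        · simp [max_eq_right h]
        · simp [max_eq_left h]
      refine le_of_eq ?_
      linear_combination (b.cartanMatrix i i * d i) * this
    · have e1 : 0 ≤ n i + q i := by simp only [hq]; omega
      have e2 : 0 ≤ d j * q j := mul_nonneg (hd j).le (le_max_right _ _)
      exact mul_nonpos_of_nonneg_of_nonpos e1
        (mul_nonpos_of_nonpos_of_nonneg (b.cartanMatrix_le_zero_of_ne i j hij) e2)
  rw [add_vecMul, add_dotProduct, ← dotProduct_mulVec q, mulVec_mulVec] at h3
  linarith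

open Matrix in
theorem sum_zsmul_root_apply_coroot (n : b.support → ℤ) (j : b.support) :
    (∑ i, n i • (IsKilling.rootSystem H).root i) ((IsKilling.rootSystem H).coroot j) =
      ((n ᵥ* b.cartanMatrix) j : ℤ) := by
  have key : ∀ i : b.support, ((b.cartanMatrix i j : ℤ) : ℂ) =
      (IsKilling.rootSystem H).root i ((IsKilling.rootSystem H).coroot j) := fun i => by
    have := b.algebraMap_cartanMatrixIn_apply ℤ i j
    simpa using this
  simp only [LinearMap.sum_apply, vecMul, dotProduct, Int.cast_sum, Int.cast_mul, key]
  refine Finset.sum_congr rfl fun i _ => ?_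
  rw [← Int.cast_smul_eq_zsmul ℂ, LinearMap.smul_apply, smul_eq_mul]

theorem ext_coroot {μ ν : Dual ℂ H} (h : ∀ i : b.support, μ ((IsKilling.rootSystem H).coroot i) =
    ν ((IsKilling.rootSystem H).coroot i)) : μ = ν :=
  b.toCoweightBasis.ext fun i => by simpa using h i

variable (b) in
open Matrix in
open scoped Classical in
-- The adjugate inverts the Cartan matrix up to its determinant, and it is integral.
theorem det_zsmul_mem_rootLattice {μ : Dual ℂ H}
    (h : ∀ i : b.support, ∃ m : ℤ, μ ((IsKilling.rootSystem H).coroot i) = m) :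
    b.cartanMatrix.det • μ ∈ rootLattice b := by
  choose m hm using h
  rw [mem_rootLattice_iff]
  refine ⟨m ᵥ* b.cartanMatrix.adjugate, ext_coroot (b := b) fun j => ?_⟩
  rw [sum_zsmul_root_apply_coroot, vecMul_vecMul, adjugate_mul, ← Int.cast_smul_eq_zsmul ℂ,
    LinearMap.smul_apply, hm]
  simp [mul_comm]

theorem IsDominant.exists_int {μ : Dual ℂ H} (h : IsDominant b μ) (i : b.support) :
    ∃ m : ℤ, μ ((IsKilling.rootSystem H).coroot i) = m := by
  obtain ⟨m, hm⟩ := h i i.2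
  exact ⟨m, by simpa using hm⟩

/-- The factor `e` admits dominant weights outside the root lattice. -/
theorem IsDominant.nonneg_of_nsmul_eq {μ : Dual ℂ H} (h : IsDominant b μ) {e : ℕ}
    {n : b.support → ℤ} (hn : e • μ = ∑ i, n i • (IsKilling.rootSystem H).root i)
    (i : b.support) : 0 ≤ n i := by
  refine nonneg_of_vecMul_cartanMatrix_nonneg (fun j => ?_) i
  obtain ⟨m, hm⟩ := h j j.2
  have := sum_zsmul_root_apply_coroot n j
  rw [← hn, LinearMap.smul_apply, hm, nsmul_eq_mul] at this
  rw [show (Matrix.vecMul n b.cartanMatrix) j = ((e * m : ℕ) : ℤ) by exact_mod_cast this.symm]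
  positivity

theorem IsDominant.zero_weightLE {μ : Dual ℂ H} (h : IsDominant b μ) (hμ : μ ∈ rootLattice b) :
    WeightLE b 0 μ := by
  obtain ⟨n, hn⟩ := mem_rootLattice_iff.mp hμ
  have h0 := h.nonneg_of_nsmul_eq (e := 1) (by simpa using hn)
  refine ⟨fun i => (n i).toNat, ?_⟩
  rw [sub_zero, hn]
  refine Finset.sum_congr rfl fun i _ => ?_
  rw [← natCast_zsmul, Int.toNat_of_nonneg (h0 i)]

theorem sum_nsmul_fundWeight_apply_coroot (ι : b.support → ℕ) (j : b.support) :
    (∑ i, ι i • fundWeight b i) ((IsKilling.rootSystem H).coroot j) = ι j := by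
  simp [LinearMap.sum_apply, fundWeight_coroot, -IsKilling.rootSystem_coroot_apply]

theorem isDominant_sum_nsmul_fundWeight (ι : b.support → ℕ) :
    IsDominant b (∑ i, ι i • fundWeight b i) := fun j hj =>
  ⟨ι ⟨j, hj⟩, sum_nsmul_fundWeight_apply_coroot ι ⟨j, hj⟩⟩

theorem sum_nsmul_fundWeight_injective :
    Function.Injective fun ι : b.support →₀ ℕ => ∑ i, ι i • fundWeight b i := by
  intro ι κ h
  ext j
  have := LinearMap.congr_fun h ((IsKilling.rootSystem H).coroot j)
  simp only [sum_nsmul_fundWeight_apply_coroot] at this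
  exact_mod_cast this

/-- There are only finitely many dominant weights below a given dominant weight. -/
theorem finite_dominant_weightLE {ϖ : Dual ℂ H} (hϖ : IsDominant b ϖ) :
    {μ | IsDominant b μ ∧ WeightLE b μ ϖ}.Finite := by
  classical
  have hdet : b.cartanMatrix.det ≠ 0 :=
    Matrix.nondegenerate_iff_det_ne_zero.mp b.cartanMatrix_nondegenerate
  set e := b.cartanMatrix.det.natAbs with he
  have he0 : 1 ≤ e := Int.natAbs_pos.mpr hdet
  have key : ∀ μ : Dual ℂ H, IsDominant b μ → ∃ n : b.support → ℤ,
      e • μ = ∑ i, n i • (IsKilling.rootSystem H).root i := fun μ hμ => by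
    rw [← mem_rootLattice_iff, ← natCast_zsmul]
    have h := det_zsmul_mem_rootLattice b hμ.exists_int
    rcases Int.natAbs_eq b.cartanMatrix.det with h' | h' <;> rw [h'] at h
    · exact h
    · rw [neg_smul] at h
      exact neg_mem_iff.mp h
  obtain ⟨N, hN⟩ := key ϖ hϖ
  refine ((Set.finite_Iic fun i => (N i).toNat).image
    fun k : b.support → ℕ => ϖ - ∑ i, k i • (IsKilling.rootSystem H).root i).subset ?_
  rintro μ ⟨hμ, k, hk⟩
  refine ⟨k, fun i => ?_, by simp only [← hk, sub_sub_cancel]⟩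
  obtain ⟨n, hn⟩ := key μ hμ
  have h0 := hμ.nonneg_of_nsmul_eq hn i
  -- Comparing simple-root coordinates of `e • (ϖ - μ)` gives `e k = N - n ≤ N`, which bounds `k`
  -- because `e ≥ 1`.
  have hsum : ∑ i, (N i - n i - e * k i) • (IsKilling.rootSystem H).root i = 0 := by
    simp only [sub_smul, Finset.sum_sub_distrib, ← hN, ← hn, mul_smul, ← Finset.smul_sum,
      natCast_zsmul, ← hk, smul_sub, sub_self]
  have := Fintype.linearIndependent_iff.mp (simpleRoots_linearIndependent b)
    (fun i => ((N i - n i - e * k i : ℤ) : ℂ)) (by simpa only [Int.cast_smul_eq_zsmul] using hsum) i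
  have h3 : N i - n i - e * k i = 0 := by exact_mod_cast this
  have h4 : (k i : ℤ) ≤ e * k i := by nlinarith
  change k i ≤ (N i).toNat
  omega

theorem admissibleExponents_finite {Pi : Set (Dual ℂ H)} (hfin : Pi.Finite)
    (hdom : ∀ ϖ ∈ Pi, IsDominant b ϖ) : (admissibleExponents b Pi).Finite := by
  have h : (⋃ ϖ ∈ Pi, {μ | IsDominant b μ ∧ WeightLE b μ ϖ}).Finite :=
    hfin.biUnion fun ϖ hϖ => finite_dominant_weightLE (hdom ϖ hϖ)
  refine (h.preimage sum_nsmul_fundWeight_injective.injOn).subset ?_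
  rintro ι ⟨ϖ, hϖ, hle⟩
  simp only [Set.mem_preimage, Set.mem_iUnion]
  exact ⟨ϖ, hϖ, isDominant_sum_nsmul_fundWeight _, hle⟩

end WeightOrder

/-! ### Leading terms in the group ring of the weights -/

section LeadingTerm

variable {L : Type*} [LieRing L] [LieAlgebra ℂ L] [FiniteDimensional ℂ L] [IsKilling ℂ L]
  {H : LieSubalgebra ℂ L} [H.IsCartanSubalgebra]
  (b : (IsKilling.rootSystem H).Base)

/-- `e^lam` occurs in `f` with coefficient `1`, and all exponents of `f` are `≼ lam`. -/
structure HasLeadingWeight (f : AddMonoidAlgebra ℤ (Dual ℂ H)) (lam : Dual ℂ H) : Prop where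
  coeff_eq_one : f.coeff lam = 1
  le_of_coeff_ne_zero : ∀ μ, f.coeff μ ≠ 0 → WeightLE b μ lam

variable {b}

theorem hasLeadingWeight_one : HasLeadingWeight b 1 0 where
  coeff_eq_one := by simp [AddMonoidAlgebra.one_def]
  le_of_coeff_ne_zero μ hμ := by
    obtain rfl : μ = 0 := by
      by_contra h
      simp [AddMonoidAlgebra.one_def, Ne.symm h] at hμ
    exact weightLE_refl b 0

theorem HasLeadingWeight.mul {f g : AddMonoidAlgebra ℤ (Dual ℂ H)} {lam nu : Dual ℂ H}
    (hf : HasLeadingWeight b f lam) (hg : HasLeadingWeight b g nu) :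
    HasLeadingWeight b (f * g) (lam + nu) where
  coeff_eq_one := by
    rw [AddMonoidAlgebra.coeff_mul_add_of_uniqueAdd, hf.coeff_eq_one, hg.coeff_eq_one, one_mul]
    intro μ ν hμ hν h
    have h1 := hf.le_of_coeff_ne_zero μ (Finsupp.mem_support_iff.mp hμ)
    have h2 := hg.le_of_coeff_ne_zero ν (Finsupp.mem_support_iff.mp hν)
    -- Since `μ + ν = lam + nu`, the deficit `nu - ν` equals the excess `μ - lam`; with `μ ≼ lam`
    -- this forces equality.
    have h3 : WeightLE b lam μ := by
      obtain ⟨n, hn⟩ := h2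
      exact ⟨n, by rw [← hn, sub_eq_sub_iff_add_eq_add, h, add_comm]⟩
    obtain rfl := h1.antisymm h3
    exact ⟨rfl, add_left_cancel h⟩
  le_of_coeff_ne_zero μ hμ := by
    classical
    rw [AddMonoidAlgebra.coeff_mul] at hμ
    obtain ⟨a, ha, h⟩ := Finset.exists_ne_zero_of_sum_ne_zero hμ
    obtain ⟨c, hc, h'⟩ := Finset.exists_ne_zero_of_sum_ne_zero h
    obtain rfl : a + c = μ := by
      by_contra h0
      simp [h0] at h'
    exact (hf.le_of_coeff_ne_zero a (Finsupp.mem_support_iff.mp ha)).add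
      (hg.le_of_coeff_ne_zero c (Finsupp.mem_support_iff.mp hc))

theorem HasLeadingWeight.pow {f : AddMonoidAlgebra ℤ (Dual ℂ H)} {lam : Dual ℂ H}
    (hf : HasLeadingWeight b f lam) (n : ℕ) : HasLeadingWeight b (f ^ n) (n • lam) := by
  induction n with
  | zero => simpa using hasLeadingWeight_one
  | succ n ih => simpa [pow_succ, add_smul] using ih.mul hf

theorem HasLeadingWeight.prod {ι : Type*} (s : Finset ι)
    {f : ι → AddMonoidAlgebra ℤ (Dual ℂ H)} {lam : ι → Dual ℂ H}
    (hf : ∀ i ∈ s, HasLeadingWeight b (f i) (lam i)) :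
    HasLeadingWeight b (∏ i ∈ s, f i) (∑ i ∈ s, lam i) := by
  classical
  induction s using Finset.induction_on with
  | empty => simpa using hasLeadingWeight_one
  | insert a s ha ih =>
    rw [Finset.prod_insert ha, Finset.sum_insert ha]
    exact (hf a (Finset.mem_insert_self a s)).mul
      (ih fun i hi => hf i (Finset.mem_insert_of_mem hi))

/-- If all dominant exponents of a polynomial expression `p(χ₁, …, χₗ)` in elements with leading
weights `ω₁, …, ωₗ` lie in a lower set, then so do the leading weights of its monomials. -/
theorem coeff_eq_zero_of_forall_dominant {χ : b.support → AddMonoidAlgebra ℤ (Dual ℂ H)}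
    (hχ : ∀ i, HasLeadingWeight b (χ i) (fundWeight b i)) (p : MvPolynomial b.support ℤ)
    {P : Dual ℂ H → Prop} (hP : ∀ μ ν, WeightLE b μ ν → P ν → P μ)
    (hp : ∀ μ, IsDominant b μ → (MvPolynomial.aeval χ p).coeff μ ≠ 0 → P μ)
    (ι : b.support →₀ ℕ) (hι : ¬ P (∑ i, ι i • fundWeight b i)) : p.coeff ι = 0 := by
  classical
  by_contra hne
  let wt : (b.support →₀ ℕ) → Dual ℂ H := fun ι => ∑ i, ι i • fundWeight b i
  let _ : PartialOrder (Dual ℂ H) :=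
    { le := WeightLE b
      le_refl := weightLE_refl b
      le_trans := fun _ _ _ => WeightLE.trans
      le_antisymm := fun _ _ => WeightLE.antisymm }
  obtain ⟨κ, hκ, hmax⟩ := (p.support.filter fun κ => ¬ P (wt κ)).exists_maximalFor wt
    ⟨ι, Finset.mem_filter.mpr ⟨MvPolynomial.mem_support_iff.mpr hne, hι⟩⟩
  rw [Finset.mem_filter, MvPolynomial.mem_support_iff] at hκ
  refine hκ.2 (hp _ (isDominant_sum_nsmul_fundWeight _) ?_)
  have hlead : ∀ κ' : b.support →₀ ℕ, HasLeadingWeight b (∏ i, χ i ^ κ' i) (wt κ') := fun κ' =>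
    HasLeadingWeight.prod _ fun i _ => (hχ i).pow _
  rw [MvPolynomial.aeval_def, MvPolynomial.eval₂_eq', AddMonoidAlgebra.coeff_sum,
    Finsupp.finsetSum_apply, Finset.sum_eq_single κ]
  · rw [← Algebra.smul_def, AddMonoidAlgebra.coeff_smul, Finsupp.smul_apply]
    rw [show (∏ i, χ i ^ κ i).coeff (∑ i, κ i • fundWeight b i) = 1 from (hlead κ).coeff_eq_one]
    simpa using hκ.1
  · intro κ' hκ' hκκ'
    rw [← Algebra.smul_def, AddMonoidAlgebra.coeff_smul, Finsupp.smul_apply]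
    suffices (∏ i, χ i ^ κ' i).coeff (wt κ) = 0 by
      change _ • (∏ i, χ i ^ κ' i).coeff (wt κ) = 0
      rw [this, smul_zero]
    -- A monomial `κ'` containing `e^(wt κ)` has leading weight above `wt κ`, hence also outside
    -- `P`; maximality of `κ` gives `κ' = κ`.
    by_contra h
    have hle : WeightLE b (wt κ) (wt κ') := (hlead κ').le_of_coeff_ne_zero _ h
    have hmem : κ' ∈ p.support.filter fun κ => ¬ P (wt κ) :=
      Finset.mem_filter.mpr ⟨hκ', fun h' => hκ.2 (hP _ _ hle h')⟩
    exact hκκ' (sum_nsmul_fundWeight_injective ((hmax hmem hle).antisymm hle))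
  · intro h
    exact absurd (MvPolynomial.mem_support_iff.mpr hκ.1) h

end LeadingTerm

/-! ### Weight bases and highest weight modules -/

section WeightBasis

variable {L : Type*} [LieRing L] [LieAlgebra ℂ L] {H : LieSubalgebra ℂ L} [H.IsCartanSubalgebra]
  {V : Type*} [AddCommGroup V] [Module ℂ V] [LieRingModule L V] [LieModule ℂ L V]

theorem mem_weightSpace_iff {μ : Dual ℂ H} {v : V} :
    v ∈ LieModule.weightSpace V (μ : H → ℂ) ↔ ∀ h : H, ⁅(h : L), v⁆ = μ h • v := by
  rw [LieModule.mem_weightSpace]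
  rfl

/-- The vectors of the basis `B` are weight vectors, with weights `μ`. -/
def IsWeightBasis {ι : Type*} (B : Basis ι ℂ V) (μ : ι → Dual ℂ H) : Prop :=
  ∀ s, ∀ h : H, ⁅(h : L), B s⁆ = μ s h • B s

theorem IsWeightBasis.repr_lie {ι : Type*} {B : Basis ι ℂ V} {μ : ι → Dual ℂ H}
    (hB : IsWeightBasis B μ) (h : H) (v : V) (s : ι) :
    B.repr ⁅(h : L), v⁆ s = μ s h * B.repr v s := by
  classical
  have : B.coord s ∘ₗ LieModule.toEnd ℂ L V h = μ s h • B.coord s := by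
    refine B.ext fun t => ?_
    rcases eq_or_ne t s with rfl | hts
    · simp [hB t h]
    · simp [hB t h, hts]
  simpa using LinearMap.congr_fun this v

theorem IsWeightBasis.eq_of_repr_ne_zero {ι : Type*} {B : Basis ι ℂ V} {μ : ι → Dual ℂ H}
    (hB : IsWeightBasis B μ) {ν : Dual ℂ H} {v : V}
    (hv : v ∈ LieModule.weightSpace V (ν : H → ℂ)) {s : ι} (hs : B.repr v s ≠ 0) : μ s = ν := by
  ext h
  have := hB.repr_lie h v s
  rw [mem_weightSpace_iff.mp hv h, map_smul, Finsupp.smul_apply, smul_eq_mul] at this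
  exact (mul_right_cancel₀ hs this).symm

theorem IsWeightBasis.mem_weightSpace {ι : Type*} {B : Basis ι ℂ V} {μ : ι → Dual ℂ H}
    (hB : IsWeightBasis B μ) (s : ι) : B s ∈ LieModule.weightSpace V (μ s : H → ℂ) :=
  mem_weightSpace_iff.mpr (hB s)

theorem mem_weightSystem_iff {ν : Dual ℂ H} : ν ∈ weightSystem H V ↔
    ∃ v ∈ LieModule.weightSpace V (ν : H → ℂ), v ≠ 0 := by
  rw [weightSystem, Set.mem_ofPred_eq, ne_eq, LieSubmodule.eq_bot_iff]
  push Not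
  rfl

theorem IsWeightBasis.weightSystem_eq {ι : Type*} {B : Basis ι ℂ V} {μ : ι → Dual ℂ H}
    (hB : IsWeightBasis B μ) : weightSystem H V = Set.range μ := by
  ext ν
  rw [mem_weightSystem_iff]
  constructor
  · rintro ⟨v, hv, hv0⟩
    obtain ⟨s, hs⟩ : ∃ s, B.repr v s ≠ 0 := by
      by_contra! h
      exact hv0 (B.repr.map_eq_zero_iff.mp (Finsupp.ext h))
    exact ⟨s, hB.eq_of_repr_ne_zero hv hs⟩
  · rintro ⟨s, rfl⟩
    exact ⟨B s, hB.mem_weightSpace s, B.ne_zero s⟩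

theorem coeff_formalChar [FiniteDimensional ℂ V] (μ : Dual ℂ H) :
    (formalChar H V).coeff μ = weightMult H V μ := rfl

theorem mem_weightSystem_of_coeff_ne_zero [FiniteDimensional ℂ V] {μ : Dual ℂ H}
    (h : (formalChar H V).coeff μ ≠ 0) : μ ∈ weightSystem H V := by
  intro h0
  refine h ?_
  rw [coeff_formalChar, weightMult, h0]
  exact_mod_cast finrank_bot ℂ V

theorem weightSystem_finite [FiniteDimensional ℂ V] : (weightSystem H V).Finite := by
  refine (finite_support_weightMult H V).subset fun μ hμ h0 => hμ ?_
  have h0 : weightMult H V μ = 0 := by simpa using h0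
  rw [weightMult] at h0
  rw [← LieSubmodule.toSubmodule_eq_bot]
  exact Submodule.finrank_eq_zero.mp h0

theorem weightSystem_eq_empty_of_subsingleton [Subsingleton V] : weightSystem H V = ∅ := by
  ext μ
  simp only [mem_weightSystem_iff, Set.mem_empty_iff_false, iff_false, not_exists, not_and]
  exact fun v _ => not_not.mpr (Subsingleton.elim v 0)

end WeightBasis

section HighestWeight

variable {L : Type*} [LieRing L] [LieAlgebra ℂ L] [FiniteDimensional ℂ L] [IsKilling ℂ L]
  {H : LieSubalgebra ℂ L} [H.IsCartanSubalgebra]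
  (b : (IsKilling.rootSystem H).Base)
  {V : Type*} [AddCommGroup V] [Module ℂ V] [LieRingModule L V] [LieModule ℂ L V]

theorem lie_mem_weightSpace_add {α μ : Dual ℂ H} {x : L} {v : V}
    (hx : x ∈ rootSpace H (α : H → ℂ)) (hv : v ∈ LieModule.weightSpace V (μ : H → ℂ)) :
    ⁅x, v⁆ ∈ LieModule.weightSpace V ((μ + α : Dual ℂ H) : H → ℂ) := by
  rw [mem_weightSpace_iff] at hv ⊢
  intro h
  have hx' : ⁅(h : L), x⁆ = α h • x := IsKilling.lie_eq_smul_of_mem_rootSpace hx h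
  rw [leibniz_lie, hx', hv, smul_lie, lie_smul, ← add_smul, LinearMap.add_apply, add_comm]

variable (H) in
theorem eq_top_of_rootSpace_le {N : Submodule ℂ L} (h0 : ∀ x ∈ H, x ∈ N)
    (hN : ∀ α : H.root, ∀ x ∈ rootSpace H (α : H → ℂ), x ∈ N) : N = ⊤ := by
  rw [eq_top_iff]
  have h := LieModule.iSup_genWeightSpace_eq_top' ℂ H L
  rw [← LieSubmodule.toSubmodule_inj, LieSubmodule.iSup_toSubmodule,
    LieSubmodule.top_toSubmodule] at h
  rw [← h]
  refine iSup_le fun χ x hx => ?_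
  by_cases hχ : χ.IsZero
  · refine h0 x ?_
    have h1 : x ∈ rootSpace H (χ : H → ℂ) := hx
    rw [hχ.eq] at h1
    simpa using h1
  · exact hN ⟨χ, by simpa using hχ⟩ x hx

/-- A highest weight vector generates under negative root vectors. -/
theorem span_highestWeight_eq_top [LieModule.IsIrreducible ℂ L V] {lam : Dual ℂ H} {v : V}
    (hv : v ∈ LieModule.weightSpace V (lam : H → ℂ)) (hv0 : v ≠ 0)
    (hpos : ∀ α : H.root, b.IsPos α → ∀ x ∈ rootSpace H (α : H → ℂ), ⁅x, v⁆ = 0) :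
    Submodule.span ℂ ({v} ∪ {w : V | ∃ μ : Dual ℂ H, WeightLE b μ lam ∧ μ ≠ lam ∧
      w ∈ LieModule.weightSpace V (μ : H → ℂ)}) = ⊤ := by
  let C : Set (Submodule ℂ V) := {N | v ∈ N ∧ ∀ α : H.root, ¬ b.IsPos α →
    ∀ x ∈ rootSpace H (α : H → ℂ), ∀ w ∈ N, ⁅x, w⁆ ∈ N}
  -- `W` is the smallest subspace that contains `v` and is stable under the non-positive root
  -- vectors. Minimality serves as the induction principle, in place of the PBW theorem.
  let W : Submodule ℂ V := sInf C
  have hvW : v ∈ W := Submodule.mem_sInf.mpr fun N hN => hN.1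
  have hneg : ∀ α : H.root, ¬ b.IsPos α → ∀ x ∈ rootSpace H (α : H → ℂ), ∀ w ∈ W, ⁅x, w⁆ ∈ W :=
    fun α hα x hx w hw => Submodule.mem_sInf.mpr fun N hN =>
      hN.2 α hα x hx w (Submodule.mem_sInf.mp hw N hN)
  have hWstable : ∀ x : L, ∀ w ∈ W, ⁅x, w⁆ ∈ W := by
    -- `N` consists of the vectors of `W` that all of `L` maps into `W`. It belongs to `C` because
    -- `x y w = [x, y] w + y x w`, so `W ≤ N` and `W` is a submodule.
    let N : Submodule ℂ V :=
      { carrier := {w | w ∈ W ∧ ∀ x : L, ⁅x, w⁆ ∈ W}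
        add_mem' := fun ha hb => ⟨W.add_mem ha.1 hb.1, fun x => by
          rw [lie_add]; exact W.add_mem (ha.2 x) (hb.2 x)⟩
        zero_mem' := ⟨W.zero_mem, fun x => by rw [lie_zero]; exact W.zero_mem⟩
        smul_mem' := fun c w hw => ⟨W.smul_mem c hw.1, fun x => by
          rw [lie_smul]; exact W.smul_mem c (hw.2 x)⟩ }
    have hN : N ∈ C := by
      refine ⟨⟨hvW, fun x => ?_⟩, fun α hα y hy w hw => ⟨hneg α hα y hy w hw.1, fun x => ?_⟩⟩
      · let K : Submodule ℂ L := W.comap ((LieModule.toEnd ℂ L V : L →ₗ[ℂ] End ℂ V).flip v)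
        have hK : K = ⊤ := by
          refine eq_top_of_rootSpace_le H (fun h hh => ?_) fun α h hh => ?_
          · change ⁅h, v⁆ ∈ W
            rw [mem_weightSpace_iff.mp hv ⟨h, hh⟩]
            exact W.smul_mem _ hvW
          · change ⁅h, v⁆ ∈ W
            by_cases hα : b.IsPos α
            · rw [hpos α hα h hh]
              exact W.zero_mem
            · exact hneg α hα h hh v hvW
        have : x ∈ K := hK ▸ Submodule.mem_top
        exact this
      · rw [leibniz_lie]
        exact W.add_mem (hw.2 _) (hneg α hα y hy _ (hw.2 x))
    intro x w hw
    exact (Submodule.mem_sInf.mp hw N hN).2 x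
  let W' : LieSubmodule ℂ L V := { W with lie_mem := fun {x w} hw => hWstable x w hw }
  have hW' : W' = ⊤ := (eq_bot_or_eq_top W').resolve_left fun h =>
    hv0 ((LieSubmodule.eq_bot_iff _).mp h v hvW)
  have hW : W = ⊤ := by
    have := congrArg LieSubmodule.toSubmodule hW'
    simpa [W'] using this
  rw [eq_top_iff, ← hW]
  -- The span in question belongs to `C` too: negative root vectors strictly lower weights.
  refine sInf_le ⟨Submodule.subset_span (Or.inl rfl), fun α hα x hx w hw => ?_⟩
  have hαneg : ∀ μ : Dual ℂ H, WeightLE b (μ + (IsKilling.rootSystem H).root α) μ := by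
    intro μ
    let := (IsKilling.rootSystem H).indexNeg
    have h := weightLE_sub_of_isPos ((RootPairing.Base.IsPos.neg_iff_not b α).mpr hα) μ
    rwa [RootPairing.indexNeg_neg, RootPairing.root_reflectionPerm, RootPairing.reflection_apply_self,
      sub_neg_eq_add] at h
  have hroot : (IsKilling.rootSystem H).root α ≠ 0 := (IsKilling.rootSystem H).ne_zero α
  have hx' : x ∈ rootSpace H ((IsKilling.rootSystem H).root α : H → ℂ) := hx
  induction hw using Submodule.span_induction with
  | mem w hw =>
    refine Submodule.subset_span (Or.inr ?_)
    rcases hw with hw | ⟨μ, hle, hne, hw⟩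
    · rw [Set.mem_singleton_iff.mp hw]
      refine ⟨lam + (IsKilling.rootSystem H).root α, hαneg _, by simpa using hroot,
        lie_mem_weightSpace_add hx' hv⟩
    · refine ⟨μ + (IsKilling.rootSystem H).root α, (hαneg _).trans hle, fun h => hne ?_,
        lie_mem_weightSpace_add hx' hw⟩
      exact hle.antisymm (h ▸ hαneg μ)
  | zero => rw [lie_zero]; exact Submodule.zero_mem _
  | add w w' _ _ h h' => rw [lie_add]; exact Submodule.add_mem _ h h'
  | smul c w _ h => rw [lie_smul]; exact Submodule.smul_mem _ c h

variable {b} in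
-- The basis is extracted from the spanning set of `span_highestWeight_eq_top`, where `v` is the
-- only listed vector of weight `lam`. The last clause yields multiplicity one.
theorem IsIrredOfHighestWeight.exists_weightBasis [FiniteDimensional ℂ V] {lam : Dual ℂ H}
    (hV : IsIrredOfHighestWeight b V lam) :
    ∃ (v : V) (B : Basis (Fin (finrank ℂ V)) ℂ V) (μ : Fin (finrank ℂ V) → Dual ℂ H),
      IsWeightBasis B μ ∧ v ∈ LieModule.weightSpace V (lam : H → ℂ) ∧ v ≠ 0 ∧
      ∀ s, WeightLE b (μ s) lam ∧ (μ s = lam → B s = v) := by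
  obtain ⟨hirr, v, hv, hv0, hpos⟩ := hV
  have hspan := span_highestWeight_eq_top b hv hv0 hpos
  let B := Basis.ofSpan hspan.ge
  have e := B.indexEquiv (Module.finBasis ℂ V)
  have key : ∀ s, ∃ μ : Dual ℂ H, B s ∈ LieModule.weightSpace V (μ : H → ℂ) ∧
      WeightLE b μ lam ∧ (μ = lam → B s = v) := by
    intro s
    rcases Basis.ofSpan_subset hspan.ge ⟨s, rfl⟩ with h | ⟨μ, h1, h2, h3⟩
    · rw [Set.mem_singleton_iff] at h
      exact ⟨lam, by rw [h]; exact hv, weightLE_refl b lam, fun _ => h⟩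
    · exact ⟨μ, h3, h1, fun h => absurd h h2⟩
  choose μ hμ1 hμ2 using key
  refine ⟨v, B.reindex e, μ ∘ e.symm, fun s => ?_, hv, hv0, fun s => ?_⟩
  · rw [Basis.reindex_apply]
    exact mem_weightSpace_iff.mp (hμ1 _)
  · rw [Basis.reindex_apply]
    exact hμ2 _

variable {b} in
theorem IsIrredOfHighestWeight.hasLeadingWeight [FiniteDimensional ℂ V] {lam : Dual ℂ H}
    (hV : IsIrredOfHighestWeight b V lam) : HasLeadingWeight b (formalChar H V) lam := by
  obtain ⟨v, B, μ, hB, hv, hv0, hμ⟩ := hV.exists_weightBasis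
  constructor
  · rw [coeff_formalChar, weightMult, Nat.cast_eq_one]
    refine finrank_eq_one_iff_of_nonzero' (⟨v, hv⟩ : LieModule.weightSpace V (lam : H → ℂ))
      (by simpa using hv0) |>.mpr ?_
    rintro ⟨w, hw⟩
    have hmem : w ∈ Submodule.span ℂ {v} := by
      rw [← B.sum_repr w]
      refine Submodule.sum_mem _ fun s _ => ?_
      by_cases hs : B.repr w s = 0
      · rw [hs, zero_smul]
        exact Submodule.zero_mem _
      · rw [(hμ s).2 (hB.eq_of_repr_ne_zero hw hs)]
        exact Submodule.smul_mem _ _ (Submodule.mem_span_singleton_self v)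
    obtain ⟨c, hc⟩ := Submodule.mem_span_singleton.mp hmem
    exact ⟨c, Subtype.ext hc⟩
  · intro ν hν
    have := mem_weightSystem_of_coeff_ne_zero hν
    rw [hB.weightSystem_eq] at this
    obtain ⟨s, rfl⟩ := this
    exact (hμ s).1

end HighestWeight

/-! ### Weights of exterior powers -/

section ExteriorWeights

variable {L : Type*} [LieRing L] [LieAlgebra ℂ L] {H : LieSubalgebra ℂ L} [H.IsCartanSubalgebra]
  {V : Type*} [AddCommGroup V] [Module ℂ V] [LieRingModule L V] [LieModule ℂ L V]

theorem IsWeightBasis.exteriorPower {ι : Type*} [LinearOrder ι] {B : Basis ι ℂ V}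
    {μ : ι → Dual ℂ H} (hB : IsWeightBasis B μ) (k : ℕ) :
    IsWeightBasis (B.exteriorPower k) fun S => ∑ s ∈ S.val, μ s := by
  intro S h
  rw [exteriorPower.basis_apply, exteriorPower.ιMulti_family, ExteriorLie.lie_ιMulti]
  have hsum : ∑ s ∈ S.val, μ s = ∑ i, μ (Set.powersetCard.ofFinEmbEquiv.symm S i) := by
    rw [Set.powersetCard.ofFinEmbEquiv_symm_apply]
    conv_lhs => rw [← Finset.map_orderEmbOfFin_univ S.val S.prop]
    rw [Finset.sum_map]
    rfl
  dsimp only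
  rw [hsum, LinearMap.sum_apply, Finset.sum_smul]
  refine Finset.sum_congr rfl fun i _ => ?_
  rw [Function.comp_apply, hB, AlternatingMap.map_update_smul]
  congr 2
  exact Function.update_eq_self _ _

theorem IsWeightBasis.weightSystem_exteriorPower {ι : Type*} [LinearOrder ι] {B : Basis ι ℂ V}
    {μ : ι → Dual ℂ H} (hB : IsWeightBasis B μ) (k : ℕ) :
    weightSystem H (⋀[ℂ]^k V) = {ν | ∃ S : Finset ι, S.card = k ∧ ∑ s ∈ S, μ s = ν} := by
  rw [(hB.exteriorPower k).weightSystem_eq]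
  ext ν
  constructor
  · rintro ⟨S, rfl⟩
    exact ⟨S.val, S.prop, rfl⟩
  · rintro ⟨S, hS, rfl⟩
    exact ⟨⟨S, hS⟩, rfl⟩

theorem IsWeightBasis.sum_apply_eq_trace {ι : Type*} [Fintype ι] {B : Basis ι ℂ V}
    {μ : ι → Dual ℂ H} (hB : IsWeightBasis B μ) (h : H) :
    (∑ s, μ s) h = LinearMap.trace ℂ V (LieModule.toEnd ℂ L V h) := by
  classical
  rw [LinearMap.trace_eq_matrix_trace ℂ B, Matrix.trace, LinearMap.sum_apply]
  refine Finset.sum_congr rfl fun s _ => ?_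
  rw [Matrix.diag_apply, LinearMap.toMatrix_apply, LieModule.toEnd_apply_apply, hB.repr_lie]
  simp

end ExteriorWeights

/-! ### Consequences of sl₂-theory, duality and faithfulness. -/

section Killing

variable {L : Type*} [LieRing L] [LieAlgebra ℂ L] [FiniteDimensional ℂ L] [IsKilling ℂ L]
  {H : LieSubalgebra ℂ L} [H.IsCartanSubalgebra]
  {V : Type*} [AddCommGroup V] [Module ℂ V] [LieRingModule L V] [LieModule ℂ L V]

theorem exists_isSl2Triple_coroot (α : H.root) : ∃ e f : L,
    IsSl2Triple ((IsKilling.rootSystem H).coroot α : L) e f ∧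
      e ∈ rootSpace H ((IsKilling.rootSystem H).root α : H → ℂ) ∧
      f ∈ rootSpace H ((-(IsKilling.rootSystem H).root α : Dual ℂ H) : H → ℂ) := by
  have hα : (α : LieModule.Weight ℂ H L).IsNonZero :=
    LieSubalgebra.isNonZero_coe_root α
  obtain ⟨h, e, f, ht, he, hf⟩ := IsKilling.exists_isSl2Triple_of_weight_isNonZero hα
  obtain rfl := ht.h_eq_coroot hα he hf
  exact ⟨e, f, ht, he, hf⟩

/-- A coroot is a commutator `⁅e, f⁆`, so it acts with trace zero, and the trace is the sum of the
weights. -/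
theorem IsWeightBasis.sum_eq_zero (b : (IsKilling.rootSystem H).Base)
    {ι : Type*} [Fintype ι] {B : Basis ι ℂ V}
    {μ : ι → Dual ℂ H} (hB : IsWeightBasis B μ) : ∑ s, μ s = 0 := by
  refine ext_coroot (b := b) fun i => ?_
  obtain ⟨e, f, ht, -, -⟩ := exists_isSl2Triple_coroot (H := H) i
  have h : LieModule.toEnd ℂ L V ⁅e, f⁆ = LieModule.toEnd ℂ L V e * LieModule.toEnd ℂ L V f -
      LieModule.toEnd ℂ L V f * LieModule.toEnd ℂ L V e := by
    ext v
    simp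
  rw [hB.sum_apply_eq_trace, ← ht.lie_e_f, h, map_sub, LinearMap.trace_mul_comm, sub_self,
    LinearMap.zero_apply]

/-- The weights of `⋀^(d-k) V` are the negatives of those of `⋀^k V`. -/
theorem IsWeightBasis.neg_mem_weightSystem_exteriorPower (b : (IsKilling.rootSystem H).Base)
    {ι : Type*} [Fintype ι] [LinearOrder ι] {B : Basis ι ℂ V} {μ : ι → Dual ℂ H}
    (hB : IsWeightBasis B μ) {k : ℕ} {ν : Dual ℂ H} (hν : ν ∈ weightSystem H (⋀[ℂ]^k V)) :
    -ν ∈ weightSystem H (⋀[ℂ]^(Fintype.card ι - k) V) := by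
  rw [hB.weightSystem_exteriorPower] at hν ⊢
  obtain ⟨S, rfl, rfl⟩ := hν
  refine ⟨Sᶜ, Finset.card_compl S, ?_⟩
  rw [eq_neg_iff_add_eq_zero, Finset.sum_compl_add_sum, hB.sum_eq_zero b]

/-- By simplicity a representation with a nonzero weight is faithful, so its weights separate the
points of `H` and embed `H` into `ι → ℂ`. -/
theorem card_support_le_finrank [IsSimple ℂ L] (b : (IsKilling.rootSystem H).Base)
    {ι : Type*} [Fintype ι] {B : Basis ι ℂ V} {μ : ι → Dual ℂ H}
    (hB : IsWeightBasis B μ) (hμ : ∃ s, μ s ≠ 0) : b.support.card ≤ Fintype.card ι := by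
  have hker : LieModule.ker ℂ L V = ⊥ := by
    refine (IsSimple.eq_bot_or_eq_top (R := ℂ) _).resolve_right fun h => ?_
    obtain ⟨s, hs⟩ := hμ
    refine hs (LinearMap.ext fun x => ?_)
    have h1 : (x : L) ∈ LieModule.ker ℂ L V := h ▸ LieSubmodule.mem_top _
    have h2 : ⁅(x : L), B s⁆ = 0 := (LieModule.mem_ker ℂ L V _).mp h1 (B s)
    rw [hB s x] at h2
    exact (smul_eq_zero.mp h2).resolve_right (B.ne_zero s)
  let φ : H →ₗ[ℂ] (ι → ℂ) := LinearMap.pi μ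
  have hφ : Function.Injective φ := by
    rw [← LinearMap.ker_eq_bot, eq_bot_iff]
    intro x hx
    have hx' : ∀ s, μ s x = 0 := fun s => congrFun (LinearMap.mem_ker.mp hx) s
    have h1 : (x : L) ∈ LieModule.ker ℂ L V := by
      rw [LieModule.mem_ker]
      refine fun v => LinearMap.congr_fun (f := LieModule.toEnd ℂ L V x) (g := 0) (B.ext fun s => ?_) v
      rw [LieModule.toEnd_apply_apply, hB s x, hx', zero_smul, LinearMap.zero_apply]
    rw [hker, LieSubmodule.mem_bot] at h1
    exact Subtype.ext h1
  have := LinearMap.finrank_le_finrank_of_injective hφ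
  rw [Module.finrank_fintype_fun_eq_card, finrank_eq_card_basis b.toCoweightBasis] at this
  simpa using this

/-! ### Invariance of weights under reflections -/

/-- Raising by `e` until the next step vanishes gives a primitive vector of weight `μ + pα`. Its
`h`-eigenvalue is a natural number `n`, and `f` can be applied `n` times without reaching zero. In
particular `μ h` is an integer. -/
theorem exists_rootString [FiniteDimensional ℂ V] {α : Dual ℂ H} (hα : α ≠ 0) {h : H} {e f : L}
    (ht : IsSl2Triple (h : L) e f) (hαh : α h = 2) (he : e ∈ rootSpace H (α : H → ℂ))
    (hf : f ∈ rootSpace H ((-α : Dual ℂ H) : H → ℂ)) {μ : Dual ℂ H} (hμ : μ ∈ weightSystem H V) :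
    ∃ p n : ℕ, μ h = n - 2 * p ∧ ∀ j ≤ n, μ + ((p : ℂ) - j) • α ∈ weightSystem H V := by
  obtain ⟨v, hv, hv0⟩ := mem_weightSystem_iff.mp hμ
  have hpow : ∀ {β ν : Dual ℂ H} {x : L} {w : V}, x ∈ rootSpace H (β : H → ℂ) →
      w ∈ LieModule.weightSpace V (ν : H → ℂ) → ∀ q : ℕ,
      (LieModule.toEnd ℂ L V x ^ q) w ∈
        LieModule.weightSpace V ((ν + (q : ℂ) • β : Dual ℂ H) : H → ℂ) := by
    intro β ν x w hx hw q
    induction q with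
    | zero => simpa using hw
    | succ q ih =>
      rw [pow_succ', Module.End.mul_apply]
      have := lie_mem_weightSpace_add hx ih
      rwa [add_assoc, show ((q : ℂ) • β + β) = ((q + 1 : ℕ) : ℂ) • β by
        push_cast; rw [add_smul, one_smul]] at this
  obtain ⟨q, hq⟩ : ∃ q : ℕ, (LieModule.toEnd ℂ L V e ^ q) v = 0 := by
    by_contra! hne
    refine Set.not_injOn_infinite_finite_image (f := fun q : ℕ => μ + (q : ℂ) • α)
      Set.infinite_univ ((weightSystem_finite (H := H) (V := V)).subset ?_) ?_
    · rintro - ⟨q, -, rfl⟩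
      exact mem_weightSystem_iff.mpr ⟨_, hpow he hv q, hne q⟩
    · intro q _ r _ hqr
      have := smul_left_injective ℂ hα (add_left_cancel hqr)
      exact_mod_cast this
  obtain ⟨p, hp, hp'⟩ := Nat.exists_not_and_succ_of_not_zero_of_exists
    (p := fun q => (LieModule.toEnd ℂ L V e ^ q) v = 0) (by simpa using hv0) ⟨q, hq⟩
  set w := (LieModule.toEnd ℂ L V e ^ p) v with hw
  have hwt := hpow he hv p
  have hprim : ht.HasPrimitiveVectorWith w (μ h + 2 * p) :=
    { ne_zero := hp
      lie_h := by
        rw [hw, mem_weightSpace_iff.mp hwt h]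
        simp [hαh, mul_comm]
      lie_e := by rw [pow_succ', Module.End.mul_apply] at hp'; exact hp' }
  obtain ⟨n, hn⟩ := hprim.exists_nat
  refine ⟨p, n, by rw [← hn]; ring, fun j hj => mem_weightSystem_iff.mpr
    ⟨_, ?_, hprim.pow_toEnd_f_ne_zero_of_eq_nat hn hj⟩⟩
  have := hpow hf hwt j
  rwa [add_assoc, smul_neg, ← sub_eq_add_neg, ← sub_smul] at this

theorem reflection_mem_weightSystem [FiniteDimensional ℂ V] (α : H.root) {μ : Dual ℂ H}
    (hμ : μ ∈ weightSystem H V) : (IsKilling.rootSystem H).reflection α μ ∈ weightSystem H V := by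
  obtain ⟨e, f, ht, he, hf⟩ := exists_isSl2Triple_coroot α
  have h2 : (IsKilling.rootSystem H).root α ((IsKilling.rootSystem H).coroot α) = 2 :=
    (IsKilling.rootSystem H).root_coroot_two α
  have h0 : (IsKilling.rootSystem H).root α ≠ 0 := (IsKilling.rootSystem H).ne_zero α
  have hrefl : (IsKilling.rootSystem H).reflection α μ =
      μ - μ ((IsKilling.rootSystem H).coroot α) • (IsKilling.rootSystem H).root α := by
    rw [RootPairing.reflection_apply]
    rfl
  rw [hrefl]
  obtain ⟨p, n, hμh, hs⟩ := exists_rootString h0 ht h2 he hf hμ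
  -- The reflected weight is entry `j = n - p` of the string. If `n ≤ p`, the opposite triple is
  -- used instead: `n' + n = 2p' + 2p` then forces `p' ≤ n'`.
  rcases le_total p n with hpn | hpn
  · have := hs (n - p) (Nat.sub_le _ _)
    rw [Nat.cast_sub hpn] at this
    rw [hμh, sub_eq_add_neg, ← neg_smul]
    convert this using 3
    ring
  · have ht' : IsSl2Triple ((-(IsKilling.rootSystem H).coroot α : H) : L) f e := by
      simpa using ht.symm
    obtain ⟨p', n', hμh', hs'⟩ := exists_rootString (neg_ne_zero.mpr h0) ht'
      (by simpa using h2) hf (by simpa using he) hμ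
    rw [map_neg, hμh] at hμh'
    have hn : n' + n = 2 * p' + 2 * p := by
      have : ((n' + n : ℕ) : ℂ) = (2 * p' + 2 * p : ℕ) := by
        push_cast
        linear_combination -hμh'
      exact_mod_cast this
    have hpn' : p' ≤ n' := by omega
    have := hs' (n' - p') (Nat.sub_le _ _)
    rw [Nat.cast_sub hpn'] at this
    rw [hμh, sub_eq_add_neg, ← neg_smul]
    convert this using 2
    rw [smul_neg, ← neg_smul]
    congr 1
    linear_combination hμh'

end Killing

/-! ### Types whose Weyl group contains `-1` -/

section SimpleReflectionMatrix

variable {n : ℕ} (C : Matrix (Fin n) (Fin n) ℤ)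

/-- The matrix, acting on row vectors, of the `i`-th simple reflection with respect to the simple
roots, for the Cartan matrix `C`. -/
def simpleReflectionMatrix (i : Fin n) : Matrix (Fin n) (Fin n) ℤ :=
  1 - Matrix.of fun j k => if k = i then C j i else 0

/-- The matrix of a Coxeter element, the product of all simple reflections. -/
def coxeterElementMatrix : Matrix (Fin n) (Fin n) ℤ :=
  ((List.finRange n).map (simpleReflectionMatrix C)).prod

/-- The exponents 9, 15, 6, 3 here and below are half the Coxeter numbers 18, 30, 12, 6. -/
theorem coxeterElementMatrix_E₇_pow : coxeterElementMatrix CartanMatrix.E₇ ^ 9 = -1 := by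
  decide +kernel

theorem coxeterElementMatrix_E₈_pow : coxeterElementMatrix CartanMatrix.E₈ ^ 15 = -1 := by
  decide +kernel

theorem coxeterElementMatrix_F₄_pow : coxeterElementMatrix CartanMatrix.F₄ ^ 6 = -1 := by
  decide +kernel

theorem coxeterElementMatrix_G₂_pow : coxeterElementMatrix CartanMatrix.G₂ ^ 3 = -1 := by
  decide +kernel

end SimpleReflectionMatrix

section NegOne

open Matrix

variable {L : Type*} [LieRing L] [LieAlgebra ℂ L] [FiniteDimensional ℂ L] [IsKilling ℂ L]
  {H : LieSubalgebra ℂ L} [H.IsCartanSubalgebra]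
  {b : (IsKilling.rootSystem H).Base} {n : ℕ} {C : Matrix (Fin n) (Fin n) ℤ}

theorem sum_vecMul_smul {R M ι κ : Type*} [CommSemiring R] [AddCommMonoid M] [Module R M]
    [Fintype ι] [Fintype κ] (c : ι → R) (A : Matrix ι κ R) (v : κ → M) :
    ∑ k, (c ᵥ* A) k • v k = ∑ j, c j • ∑ k, A j k • v k := by
  simp only [vecMul, dotProduct, Finset.sum_smul, Finset.smul_sum, smul_smul]
  exact Finset.sum_comm

theorem sum_simpleReflectionMatrix_smul_root (e : b.support ≃ Fin n)
    (he : ∀ i j, b.cartanMatrix i j = C (e i) (e j)) (i : Fin n) (c : Fin n → ℂ) :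
    ∑ k, (c ᵥ* (simpleReflectionMatrix C i).map (Int.cast : ℤ → ℂ)) k •
        (IsKilling.rootSystem H).root (e.symm k) =
      (IsKilling.rootSystem H).reflection (e.symm i)
        (∑ k, c k • (IsKilling.rootSystem H).root (e.symm k)) := by
  rw [sum_vecMul_smul, map_sum]
  refine Finset.sum_congr rfl fun j _ => ?_
  rw [map_smul, RootPairing.reflection_apply_root]
  have hp : (IsKilling.rootSystem H).pairing (e.symm j) (e.symm i) = (C j i : ℂ) := by
    have h := b.algebraMap_cartanMatrixIn_apply ℤ (e.symm j) (e.symm i)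
    rw [← h, show b.cartanMatrixIn ℤ (e.symm j) (e.symm i) = C j i by
      simpa using he (e.symm j) (e.symm i)]
    simp
  rw [hp]
  congr 1
  simp [simpleReflectionMatrix, Matrix.one_apply, sub_smul, Finset.sum_sub_distrib, ite_smul,
    apply_ite (Int.cast : ℤ → ℂ)]

/-- If a power of the Coxeter element is `-1`, then sets of weights that are stable under simple
reflections are symmetric. -/
theorem neg_mem_of_coxeterElementMatrix_pow (e : b.support ≃ Fin n)
    (he : ∀ i j, b.cartanMatrix i j = C (e i) (e j)) {N : ℕ}
    (hN : coxeterElementMatrix C ^ N = -1) {Γ : Set (Dual ℂ H)}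
    (hΓ : ∀ i : b.support, ∀ μ ∈ Γ, (IsKilling.rootSystem H).reflection i μ ∈ Γ)
    {μ : Dual ℂ H} (hμ : μ ∈ Γ) : -μ ∈ Γ := by
  let φ : (Fin n → ℂ) → Dual ℂ H := fun c => ∑ k, c k • (IsKilling.rootSystem H).root (e.symm k)
  -- In simple-root coordinates, the matrices preserving `Γ` form a monoid containing the simple
  -- reflections, hence every power of the Coxeter element.
  let S : Submonoid (Matrix (Fin n) (Fin n) ℤ) :=
    { carrier := {M | ∀ c, φ c ∈ Γ → φ (c ᵥ* M.map (Int.cast : ℤ → ℂ)) ∈ Γ}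
      one_mem' := fun c hc => by simpa using hc
      mul_mem' := fun {M M'} hM hM' c hc => by
        have h := hM' _ (hM c hc)
        have hmap : (M * M').map (Int.cast : ℤ → ℂ) = M.map Int.cast * M'.map Int.cast :=
          Matrix.map_mul (f := Int.castRingHom ℂ)
        rw [hmap, ← vecMul_vecMul]
        exact h }
  have hS : coxeterElementMatrix C ^ N ∈ S := by
    refine pow_mem (list_prod_mem fun M hM => ?_) N
    obtain ⟨i, -, rfl⟩ := List.mem_map.mp hM
    intro c hc
    have := hΓ (e.symm i) _ hc
    rwa [← sum_simpleReflectionMatrix_smul_root e he] at this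
  obtain ⟨c, rfl⟩ : ∃ c, φ c = μ := by
    refine ⟨fun k => b.toWeightBasis.repr μ (e.symm k), ?_⟩
    conv_rhs => rw [← b.toWeightBasis.sum_repr μ]
    simp only [φ, RootPairing.Base.toWeightBasis_apply]
    exact e.symm.sum_comp fun i => b.toWeightBasis.repr μ i • (IsKilling.rootSystem H).root i
  rw [hN] at hS
  have h := hS c hμ
  have hneg : ((-1 : Matrix (Fin n) (Fin n) ℤ).map (Int.cast : ℤ → ℂ)) = -1 := by
    ext i j
    simp [Matrix.one_apply, apply_ite (Int.cast : ℤ → ℂ)]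
  rw [hneg, vecMul_neg, vecMul_one] at h
  simpa [φ] using h

theorem neg_mem_weightSystem {V : Type*} [AddCommGroup V] [Module ℂ V] [LieRingModule L V]
    [LieModule ℂ L V] [FiniteDimensional ℂ V]
    (hC : HasCartanMatrix b CartanMatrix.E₇ ∨ HasCartanMatrix b CartanMatrix.E₈ ∨
      HasCartanMatrix b CartanMatrix.F₄ ∨ HasCartanMatrix b CartanMatrix.G₂)
    {μ : Dual ℂ H} (hμ : μ ∈ weightSystem H V) : -μ ∈ weightSystem H V := by
  have hΓ : ∀ i : b.support, ∀ μ ∈ weightSystem H V,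
      (IsKilling.rootSystem H).reflection i μ ∈ weightSystem H V :=
    fun i μ hμ => reflection_mem_weightSystem i.1 hμ
  rcases hC with ⟨e, he⟩ | ⟨e, he⟩ | ⟨e, he⟩ | ⟨e, he⟩
  · exact neg_mem_of_coxeterElementMatrix_pow e he coxeterElementMatrix_E₇_pow hΓ hμ
  · exact neg_mem_of_coxeterElementMatrix_pow e he coxeterElementMatrix_E₈_pow hΓ hμ
  · exact neg_mem_of_coxeterElementMatrix_pow e he coxeterElementMatrix_F₄_pow hΓ hμ
  · exact neg_mem_of_coxeterElementMatrix_pow e he coxeterElementMatrix_G₂_pow hΓ hμ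

end NegOne

/-! ### Weights below a pivotal set -/

section Pivotal

variable {L : Type*} [LieRing L] [LieAlgebra ℂ L] [FiniteDimensional ℂ L]
  {H : LieSubalgebra ℂ L} [H.IsCartanSubalgebra]

theorem HasCartanMatrix.det_eq [IsKilling ℂ L] {b : (IsKilling.rootSystem H).Base}
    [DecidableEq b.support] {n : ℕ}
    {C : Matrix (Fin n) (Fin n) ℤ} (h : HasCartanMatrix b C) : b.cartanMatrix.det = C.det := by
  obtain ⟨e, he⟩ := h
  rw [← Matrix.det_submatrix_equiv_self e C]
  congr 1
  ext i j
  exact he i j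

theorem HasCartanMatrix.card_support [IsKilling ℂ L] {b : (IsKilling.rootSystem H).Base} {n : ℕ}
    {C : Matrix (Fin n) (Fin n) ℤ} (h : HasCartanMatrix b C) : b.support.card = n := by
  obtain ⟨e, -⟩ := h
  simpa using Fintype.card_congr e

theorem IsPivotal.finite [IsKilling ℂ L] {b : (IsKilling.rootSystem H).Base}
    {V : Type*} [AddCommGroup V] [Module ℂ V] [LieRingModule L V]
    [LieModule ℂ L V] [FiniteDimensional ℂ V] {Pi : Set (Dual ℂ H)} (hPi : IsPivotal b V Pi) :
    Pi.Finite := by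
  refine ((Set.finite_Iic (finrank ℂ V)).biUnion
    fun k _ => weightSystem_finite (H := H) (V := ⋀[ℂ]^k V)).subset fun ϖ hϖ => ?_
  obtain ⟨k, hk⟩ := Set.mem_iUnion.mp (hPi.subset hϖ)
  refine Set.mem_biUnion (x := k) ?_ hk
  by_contra hlt
  have : finrank ℂ (⋀[ℂ]^k V) = 0 := by
    rw [exteriorPower.finrank_eq, Nat.choose_eq_zero_of_lt (by simpa using hlt)]
  have : Subsingleton (⋀[ℂ]^k V) := Module.finrank_zero_iff.mp this
  rw [weightSystem_eq_empty_of_subsingleton] at hk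
  exact hk

variable [IsSimple ℂ L] {b : (IsKilling.rootSystem H).Base}
  {V : Type*} [AddCommGroup V] [Module ℂ V] [LieRingModule L V] [LieModule ℂ L V]
  [FiniteDimensional ℂ V] {ω : Dual ℂ H} {Pi : Set (Dual ℂ H)}

theorem IsIrredOfHighestWeight.mem_weightSystem (hV : IsIrredOfHighestWeight b V ω) :
    ω ∈ weightSystem H V := by
  obtain ⟨-, v, hv, hv0, -⟩ := hV
  exact mem_weightSystem_iff.mpr ⟨v, hv, hv0⟩

open scoped Classical in
-- The determinant bound gives `e ≤ d/2`, so a sum of any `e` weights of `V` is dominated by some `ϖ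
-- ∈ Pi`. Modulo the root lattice, `ϖ ≡ eω ≡ 0`.
theorem IsIrredOfHighestWeight.exists_zero_weightLE (hω : ω ≠ 0)
    (hV : IsIrredOfHighestWeight b V ω) (hPi : IsPivotal b V Pi)
    (hdet : 2 * b.cartanMatrix.det.natAbs ≤ b.support.card) :
    ∃ ϖ ∈ Pi, WeightLE b 0 ϖ := by
  obtain ⟨v, B, μ, hB, hv, hv0, hμ⟩ := hV.exists_weightBasis
  have hωV := hV.mem_weightSystem
  set e := b.cartanMatrix.det.natAbs with he
  have he0 : 1 ≤ e := Int.natAbs_pos.mpr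
    (Matrix.nondegenerate_iff_det_ne_zero.mp b.cartanMatrix_nondegenerate)
  have hcard : b.support.card ≤ finrank ℂ V := by
    have h := hωV
    rw [hB.weightSystem_eq] at h
    obtain ⟨s, hs⟩ := h
    simpa using card_support_le_finrank b hB ⟨s, hs ▸ hω⟩
  have heω : e • ω ∈ rootLattice b := by
    -- Integrality of `ω` on the simple coroots comes from the root strings through it.
    have h := det_zsmul_mem_rootLattice b (μ := ω) fun i => by
      obtain ⟨x, y, ht, hx, hy⟩ := exists_isSl2Triple_coroot (H := H) i
      obtain ⟨p, n, h, -⟩ := exists_rootString ((IsKilling.rootSystem H).ne_zero i) ht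
        ((IsKilling.rootSystem H).root_coroot_two i) hx hy hωV
      exact ⟨n - 2 * p, by rw [h]; push_cast; ring⟩
    rw [← natCast_zsmul]
    rcases Int.natAbs_eq b.cartanMatrix.det with h' | h' <;> rw [h'] at h
    · exact h
    · rw [neg_smul] at h
      exact neg_mem_iff.mp h
  obtain ⟨S, -, hS⟩ := Finset.exists_subset_card_eq (s := (Finset.univ : Finset (Fin (finrank ℂ V))))
    (n := e) (by rw [Finset.card_univ, Fintype.card_fin]; omega)
  have hmem : ∑ s ∈ S, μ s ∈ weightSystem H (⋀[ℂ]^e V) := by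
    rw [hB.weightSystem_exteriorPower]
    exact ⟨S, hS, rfl⟩
  obtain ⟨ϖ, hϖ, hle⟩ := hPi.dominates e he0 (by omega) _ hmem
  refine ⟨ϖ, hϖ, (hPi.dominant ϖ hϖ).zero_weightLE ?_⟩
  have h1 : e • ω - ∑ s ∈ S, μ s ∈ rootLattice b := by
    rw [← hS, ← Finset.sum_const, ← Finset.sum_sub_distrib]
    exact AddSubgroup.sum_mem _ fun s _ => (hμ s).1.sub_mem_rootLattice
  have h2 := AddSubgroup.add_mem _ (AddSubgroup.sub_mem _ hle.sub_mem_rootLattice h1) heω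
  rwa [sub_sub_sub_cancel_right, sub_add_cancel] at h2

/-- The extreme degrees `k = 0` and `k = d` contribute only the weight 0, degrees above `d`
contribute none, and degrees `d/2 < k < d` reduce to `d - k` by duality and symmetry. -/
theorem IsIrredOfHighestWeight.exists_weightLE_of_neg_mem
    (hV : IsIrredOfHighestWeight b V ω) (hPi : IsPivotal b V Pi)
    (hneg : ∀ k, ∀ μ ∈ weightSystem H (⋀[ℂ]^k V), -μ ∈ weightSystem H (⋀[ℂ]^k V))
    (h0 : ∃ ϖ ∈ Pi, WeightLE b 0 ϖ) (k : ℕ) {ν : Dual ℂ H}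
    (hν : ν ∈ weightSystem H (⋀[ℂ]^k V)) : ∃ ϖ ∈ Pi, WeightLE b ν ϖ := by
  obtain ⟨-, B, μ, hB, -⟩ := hV.exists_weightBasis
  obtain ⟨S, hS, hSν⟩ := (hB.weightSystem_exteriorPower k).subset hν
  have hle : k ≤ finrank ℂ V := by
    rw [← hS]
    exact (Finset.card_le_univ S).trans_eq (Fintype.card_fin _)
  rcases Nat.eq_zero_or_pos k with rfl | hk
  · rw [Finset.card_eq_zero] at hS
    rw [← hSν, hS, Finset.sum_empty]
    exact h0
  · rcases hle.eq_or_lt with rfl | hlt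
    · have hSu : S = Finset.univ := (Finset.card_eq_iff_eq_univ S).mp (by rw [hS, Fintype.card_fin])
      rw [← hSν, hSu, hB.sum_eq_zero b]
      exact h0
    · by_cases hk2 : k ≤ finrank ℂ V / 2
      · exact hPi.dominates k hk hk2 ν hν
      · have h1 := hB.neg_mem_weightSystem_exteriorPower b hν
        rw [Fintype.card_fin] at h1
        have h2 := hneg _ _ h1
        rw [neg_neg] at h2
        exact hPi.dominates _ (by omega) (by omega) ν h2

end Pivotal

end

theorem lemma3p3
    {L : Type*} [LieRing L] [LieAlgebra ℂ L] [FiniteDimensional ℂ L] [LieAlgebra.IsSimple ℂ L]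
    (H : LieSubalgebra ℂ L) [H.IsCartanSubalgebra]
    (b : (LieAlgebra.IsKilling.rootSystem H).Base)
    -- the fundamental representations
    (F : b.support → Type*) [∀ i, AddCommGroup (F i)] [∀ i, Module ℂ (F i)]
    [∀ i, LieRingModule L (F i)] [∀ i, LieModule ℂ L (F i)] [∀ i, FiniteDimensional ℂ (F i)]
    (hF : ∀ i, IsIrredOfHighestWeight b (F i) (fundWeight b i))
    -- the representation `ρ_ω`, with `ω ≠ 0`
    (V : Type*) [AddCommGroup V] [Module ℂ V] [LieRingModule L V] [LieModule ℂ L V]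
    [FiniteDimensional ℂ V]
    (ω : Module.Dual ℂ H) (hω : ω ≠ 0) (hV : IsIrredOfHighestWeight b V ω)
    (Pi : Set (Module.Dual ℂ H)) (hPi : IsPivotal b V Pi)
    -- the expansion of the `k`-th exterior character, with coefficients `N_ι = (p k).coeff ι`
    (p : ℕ → MvPolynomial b.support ℤ)
    (hp : ∀ k, MvPolynomial.aeval (fun i => formalChar H (F i)) (p k)
      = formalChar H (⋀[ℂ]^k V)) :
    (admissibleExponents b Pi).Finite ∧
    (∀ k, 1 ≤ k → k ≤ Module.finrank ℂ V / 2 →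
      ∀ ι, ι ∉ admissibleExponents b Pi → (p k).coeff ι = 0) ∧
    (HasCartanMatrix b CartanMatrix.E₆ →
      ∀ ι, ι ∉ admissibleExponents b Pi → (p 0).coeff ι = 0) ∧
    (HasCartanMatrix b CartanMatrix.E₇ ∨ HasCartanMatrix b CartanMatrix.E₈ ∨
      HasCartanMatrix b CartanMatrix.F₄ ∨ HasCartanMatrix b CartanMatrix.G₂ →
      ∀ k, ∀ ι, ι ∉ admissibleExponents b Pi → (p k).coeff ι = 0) := by
  classical
  have key : ∀ k, (∀ μ ∈ weightSystem H (⋀[ℂ]^k V), ∃ ϖ ∈ Pi, WeightLE b μ ϖ) →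
      ∀ ι, ι ∉ admissibleExponents b Pi → (p k).coeff ι = 0 := by
    intro k hk ι hι
    refine coeff_eq_zero_of_forall_dominant (fun i => (hF i).hasLeadingWeight) (p k)
      (P := fun μ => ∃ ϖ ∈ Pi, WeightLE b μ ϖ) ?_ ?_ ι hι
    · rintro μ ν hle ⟨ϖ, hϖ, h⟩
      exact ⟨ϖ, hϖ, hle.trans h⟩
    · intro μ _ hμ
      rw [hp k] at hμ
      exact hk μ (mem_weightSystem_of_coeff_ne_zero hμ)
  have h0 : 2 * b.cartanMatrix.det.natAbs ≤ b.support.card → ∃ ϖ ∈ Pi, WeightLE b 0 ϖ :=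
    fun h => hV.exists_zero_weightLE hω hPi (by convert h)
  refine ⟨admissibleExponents_finite hPi.finite hPi.dominant,
    fun k h1 h2 => key k fun μ hμ => hPi.dominates k h1 h2 μ hμ, fun hE => key 0 fun μ hμ => ?_,
    fun hE k => key k fun μ hμ => hV.exists_weightLE_of_neg_mem hPi
      (fun k μ hμ => neg_mem_weightSystem hE hμ) (h0 ?_) k hμ⟩
  · obtain ⟨-, B, μ', hB, -⟩ := hV.exists_weightBasis
    obtain ⟨S, hS, rfl⟩ := (hB.weightSystem_exteriorPower 0).subset hμ
    rw [Finset.card_eq_zero.mp hS, Finset.sum_empty]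
    refine h0 ?_
    -- The determinant is 3 and the rank 6, so the bound holds with equality.
    rw [hE.det_eq, hE.card_support, CartanMatrix.E₆_det]
    decide
  -- The determinants are 2, 1, 1, 1 and the ranks 7, 8, 4, 2.
  · rcases hE with hE | hE | hE | hE
    · rw [hE.det_eq, hE.card_support, CartanMatrix.E₇_det]
      decide
    · rw [hE.det_eq, hE.card_support, CartanMatrix.E₈_det]
      decide
    · rw [hE.det_eq, hE.card_support, CartanMatrix.F₄_det]
      decide
    · rw [hE.det_eq, hE.card_support, CartanMatrix.G₂_det]
      decide
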